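/- A partition is a finite nonincreasing sequence of positive integers $\lambda = (\lambda_1, \dots, \lambda_r)$ (possibly empty), with Young diagram having $\lambda_i$ left-justified cells in row $i$. The hook length of a cell is the number of cells of the diagram that are equal to it, to its right in the same row, or below it in the same column. For a set $A$ of positive integers, an $A$-core is a partition no cell of which has hook length in $A$. A partition $\mu = (\mu_1,\dots,\mu_s)$ is a subpartition of $\lambda$ if $s \le r$ and $\mu_i \le \lambda_i$ for all $1 \le i \le s$. A triple $(a,b,c)$ of positive integers is UM if some $\{a,b,c\}$-core contains every other $\{a,b,c\}$-core as a subpartition. A triple $(d,e,f)$ of positive integers is aprimitive if at least one of $d, e, f$ is a linear combination of the other two with nonnegative integer coefficients. **Theorem 1.3.** Let $a, b, c$ be positive integers with $\gcd(a,b,c) = 1$, let $p = \gcd(a,b)$, $q = \gcd(a,c)$, $r = \gcd(b,c)$, and let $d, e, f$ be the (necessarily positive) integers such that $a = dpq$, $b = epr$ and $c = fqr$. If $(a,b,c)$ is UM, then $(d,e,f)$ is aprimitive. -/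

import Mathlib

/-- The number of cells of the Young diagram `μ` that lie to the right of (in the same row),
below (in the same column), or are equal to the cell `c`. Cells are pairs `(row, column)`. -/
def cellHookLength (μ : YoungDiagram) (c : ℕ × ℕ) : ℕ :=
  (μ.cells.filter fun x => (x.1 = c.1 ∧ c.2 ≤ x.2) ∨ (x.2 = c.2 ∧ c.1 ≤ x.1)).card

/-- A partition (given by its Young diagram) is an `A`-core if no cell of its Young diagram has
hook length in `A`. -/
def IsCorePartition (A : Set ℕ) (μ : YoungDiagram) : Prop :=
  ∀ c ∈ μ.cells, cellHookLength μ c ∉ A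

/-- `μ` is a subpartition of `ν`: `μ` has at most as many parts as `ν` (the number of parts of a
partition is the length of the first column of its diagram), and each part of `μ` is at most the
corresponding part of `ν`. -/
def IsSubpartition (μ ν : YoungDiagram) : Prop :=
  μ.colLen 0 ≤ ν.colLen 0 ∧ ∀ i < μ.colLen 0, μ.rowLen i ≤ ν.rowLen i

/-- The set `A` is UM: some `A`-core contains every `A`-core as a subpartition. -/
def IsUM (A : Set ℕ) : Prop :=
  ∃ κ : YoungDiagram, IsCorePartition A κ ∧
    ∀ μ : YoungDiagram, IsCorePartition A μ → IsSubpartition μ κ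

/-- One of `d`, `e`, `f` is a linear combination of the other two with nonnegative integer
coefficients, i.e. lies in the additive submonoid of `ℕ` they generate. -/
def IsAprimitive (d e f : ℕ) : Prop :=
  d ∈ AddSubmonoid.closure ({e, f} : Set ℕ) ∨
  e ∈ AddSubmonoid.closure ({d, f} : Set ℕ) ∨
  f ∈ AddSubmonoid.closure ({d, e} : Set ℕ)

/-! Encode a partition by the positions of the vertical steps of its boundary (`mayaSet`). Being an
{a,b,c}-core means that the complementary set is closed under adding a, b and c. The semigroup S =
⟨a,b,c⟩, shifted by its number of gaps, is therefore the complement for some core. A maximal core κ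
contains this core and its own transpose. So κ is self-conjugate, and counting gaps shows that its
complement is a shift of S; hence S is symmetric (`IsUM.isSymmTriple`).

Symmetry survives dividing two generators by a common factor coprime to the third
(`IsSymmTriple.of_mul`). Removing p, q and r in turn makes ⟨d,e,f⟩ symmetric with pairwise coprime
generators. If d is the least of them, the elements ue + vf in a K × L box are Apéry elements
distinct mod d, so KL ≤ d; a 2 × 2 determinant divisible by d then forces a redundant generator
(`IsSymmTriple.isAprimitive_of_le`). -/

/-! ### Hook lengths, transposition and containment. -/

theorem cellHookLength_add {μ : YoungDiagram} {i j : ℕ} (h : (i, j) ∈ μ) :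
    cellHookLength μ (i, j) + i + j + 1 = μ.rowLen i + μ.colLen j := by
  have hj : j < μ.rowLen i := YoungDiagram.mem_iff_lt_rowLen.1 h
  have hi : i < μ.colLen j := YoungDiagram.mem_iff_lt_colLen.1 h
  have hrow : (μ.cells.filter fun x => x.1 = i ∧ j ≤ x.2) =
      (Finset.Ico j (μ.rowLen i)).image fun y => (i, y) := by
    ext ⟨x, y⟩
    simp only [Finset.mem_filter, YoungDiagram.mem_cells, Finset.mem_image, Finset.mem_Ico,
      Prod.mk.injEq, YoungDiagram.mem_iff_lt_rowLen]
    constructor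
    · rintro ⟨h1, rfl, h2⟩
      exact ⟨y, ⟨h2, h1⟩, rfl, rfl⟩
    · rintro ⟨z, ⟨h1, h2⟩, rfl, rfl⟩
      exact ⟨h2, rfl, h1⟩
  have hcol : (μ.cells.filter fun x => x.2 = j ∧ i ≤ x.1) =
      (Finset.Ico i (μ.colLen j)).image fun y => (y, j) := by
    ext ⟨x, y⟩
    simp only [Finset.mem_filter, YoungDiagram.mem_cells, Finset.mem_image, Finset.mem_Ico,
      Prod.mk.injEq, YoungDiagram.mem_iff_lt_colLen]
    constructor
    · rintro ⟨h1, rfl, h2⟩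
      exact ⟨x, ⟨h2, h1⟩, rfl, rfl⟩
    · rintro ⟨z, ⟨h1, h2⟩, rfl, rfl⟩
      exact ⟨h2, rfl, h1⟩
  have hinter : (μ.cells.filter fun x => x.1 = i ∧ j ≤ x.2) ∩
      (μ.cells.filter fun x => x.2 = j ∧ i ≤ x.1) = {(i, j)} := by
    ext ⟨x, y⟩
    simp only [Finset.mem_inter, Finset.mem_filter, YoungDiagram.mem_cells, Finset.mem_singleton,
      Prod.mk.injEq]
    constructor
    · rintro ⟨⟨-, rfl, -⟩, -, rfl, -⟩
      exact ⟨rfl, rfl⟩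
    · rintro ⟨rfl, rfl⟩
      exact ⟨⟨h, rfl, le_rfl⟩, h, rfl, le_rfl⟩
  have key := Finset.card_union_add_card_inter (μ.cells.filter fun x => x.1 = i ∧ j ≤ x.2)
    (μ.cells.filter fun x => x.2 = j ∧ i ≤ x.1)
  rw [hinter, ← Finset.filter_or, hrow, hcol,
    Finset.card_image_of_injective _ (fun _ _ h => (Prod.mk.inj h).2),
    Finset.card_image_of_injective _ (fun _ _ h => (Prod.mk.inj h).1), Nat.card_Ico, Nat.card_Ico,
    Finset.card_singleton] at key
  unfold cellHookLength
  dsimp only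
  omega

theorem cellHookLength_transpose {μ : YoungDiagram} {i j : ℕ} (h : (i, j) ∈ μ) :
    cellHookLength μ.transpose (j, i) = cellHookLength μ (i, j) := by
  have h1 := cellHookLength_add h
  have h2 := cellHookLength_add (μ := μ.transpose) (i := j) (j := i) (by simpa using h)
  simp only [YoungDiagram.rowLen_transpose, YoungDiagram.colLen_transpose] at h2
  omega

theorem IsCorePartition.transpose {A : Set ℕ} {μ : YoungDiagram} (h : IsCorePartition A μ) :
    IsCorePartition A μ.transpose := by
  rintro ⟨i, j⟩ hc
  have hc' : (j, i) ∈ μ := by simpa using hc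
  rw [cellHookLength_transpose hc']
  exact h _ hc'

theorem IsSubpartition.le {μ ν : YoungDiagram} (h : IsSubpartition μ ν) : μ ≤ ν := by
  rintro ⟨i, j⟩ hc
  have hc' : (i, j) ∈ μ := hc
  have h0 : i < μ.colLen 0 :=
    YoungDiagram.mem_iff_lt_colLen.1 (μ.up_left_mem le_rfl (Nat.zero_le j) hc')
  have hj := YoungDiagram.mem_iff_lt_rowLen.1 hc'
  exact YoungDiagram.mem_iff_lt_rowLen.2 (hj.trans_le (h.2 i h0))

/-! ### Maya sets and cores. -/

/-- The edge sequence of a Young diagram: the positions of the vertical steps of its boundary. -/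
def YoungDiagram.mayaSet (μ : YoungDiagram) : Set ℤ :=
  {x | ∃ i : ℕ, x = μ.rowLen i - i - 1}

/-- Every boundary step is vertical (one per row) or horizontal (one per column); the complement
consists of the horizontal ones. -/
theorem YoungDiagram.notMem_mayaSet_iff {μ : YoungDiagram} {x : ℤ} :
    x ∉ μ.mayaSet ↔ ∃ j : ℕ, x = j - μ.colLen j := by
  constructor
  · intro hx
    have hex : ∃ i : ℕ, (μ.rowLen i : ℤ) - i - 1 ≤ x := by
      refine ⟨μ.rowLen 0 + x.natAbs, ?_⟩
      have := μ.rowLen_anti 0 (μ.rowLen 0 + x.natAbs) (Nat.zero_le _)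
      omega
    classical
    obtain ⟨i, hi, hmin⟩ : ∃ i : ℕ, (μ.rowLen i : ℤ) - i - 1 ≤ x ∧
        ∀ k < i, ¬ ((μ.rowLen k : ℤ) - k - 1 ≤ x) :=
      ⟨Nat.find hex, Nat.find_spec hex, fun k hk => Nat.find_min hex hk⟩
    have hne : x ≠ μ.rowLen i - i - 1 := fun h => hx ⟨i, h⟩
    obtain ⟨j, hj⟩ : ∃ j : ℕ, (j : ℤ) = x + i := ⟨(x + i).toNat, by omega⟩
    have hle : μ.colLen j ≤ i := by
      by_contra! hlt
      have := YoungDiagram.mem_iff_lt_rowLen.1 (YoungDiagram.mem_iff_lt_colLen.2 hlt)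
      omega
    have hge : i ≤ μ.colLen j := by
      rcases i with _ | i
      · exact Nat.zero_le _
      · have := hmin i (Nat.lt_succ_self i)
        exact YoungDiagram.mem_iff_lt_colLen.1 (YoungDiagram.mem_iff_lt_rowLen.2 (by omega))
    exact ⟨j, by omega⟩
  · rintro ⟨j, hj⟩ ⟨i, hi⟩
    by_cases h : (i, j) ∈ μ
    · have h1 := YoungDiagram.mem_iff_lt_rowLen.1 h
      have h2 := YoungDiagram.mem_iff_lt_colLen.1 h
      omega
    · have h1 := mt YoungDiagram.mem_iff_lt_rowLen.2 h
      have h2 := mt YoungDiagram.mem_iff_lt_colLen.2 h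
      omega

/-- The hook length of (i, j) is the position of the vertical step of row i minus that of the
horizontal step of column j. Conversely, a horizontal step preceding a vertical one determines a
cell. -/
theorem isCorePartition_iff_mayaSet {A : Set ℕ} (hA : 0 ∉ A) {μ : YoungDiagram} :
    IsCorePartition A μ ↔ ∀ x ∉ μ.mayaSet, ∀ a ∈ A, x + a ∉ μ.mayaSet := by
  constructor
  · intro h x hx a ha hxa
    obtain ⟨j, hj⟩ := YoungDiagram.notMem_mayaSet_iff.1 hx
    obtain ⟨i, hi⟩ := hxa
    have ha0 : 0 < a := Nat.pos_of_ne_zero fun h0 => hA (h0 ▸ ha)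
    have hm : (i, j) ∈ μ := by
      by_contra hm
      have h1 := mt YoungDiagram.mem_iff_lt_rowLen.2 hm
      have h2 := mt YoungDiagram.mem_iff_lt_colLen.2 hm
      omega
    have hk := cellHookLength_add hm
    have heq : cellHookLength μ (i, j) = a := by omega
    exact h _ hm (heq ▸ ha)
  · rintro h ⟨i, j⟩ hc ha
    have hk := cellHookLength_add hc
    refine h _ (YoungDiagram.notMem_mayaSet_iff.2 ⟨j, rfl⟩) _ ha ⟨i, ?_⟩
    omega

theorem YoungDiagram.mayaSet_transpose {μ : YoungDiagram} {x : ℤ} :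
    x ∈ μ.transpose.mayaSet ↔ -1 - x ∉ μ.mayaSet := by
  rw [YoungDiagram.notMem_mayaSet_iff]
  simp only [YoungDiagram.mayaSet, Set.mem_ofPred_eq, YoungDiagram.rowLen_transpose]
  constructor <;> rintro ⟨i, hi⟩ <;> exact ⟨i, by omega⟩

/-- Every subset of `ℕ` with finite complement is, up to a shift by the size of its complement, the
complement of the Maya set of a Young diagram. -/
theorem exists_youngDiagram_mayaSet (s : Set ℕ) (hs : sᶜ.Finite) :
    ∃ μ : YoungDiagram, ∀ x : ℤ, x ∉ μ.mayaSet ↔ ∃ n ∈ s, x = n - hs.toFinset.card := by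
  classical
  set G := hs.toFinset with hG
  have hinf : s.Infinite := by
    simpa using hs.infinite_compl
  have hinf' : {n | n ∈ s}.Infinite := hinf
  set γ : ℕ → ℕ := Nat.nth (· ∈ s) with hγ
  have hmono : StrictMono γ := Nat.nth_strictMono hinf'
  -- Column j has one cell for each gap above the j-th element of `s`.
  let col : ℕ → ℕ := fun j => (G.filter fun g => γ j < g).card
  have hanti : Antitone col := fun j k hjk => Finset.card_le_card fun g hg => by
    simp only [Finset.mem_filter] at hg ⊢
    exact ⟨hg.1, (hmono.monotone hjk).trans_lt hg.2⟩
  have hcol : ∀ j, γ j + col j = j + G.card := by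
    intro j
    have h1 : Nat.count (· ∈ s) (γ j) = j := Nat.count_nth_of_infinite hinf' j
    rw [Nat.count_eq_card_filter_range] at h1
    have h2 := Finset.card_filter_add_card_filter_not (s := Finset.range (γ j)) (· ∈ s)
    have h3 := Finset.card_filter_add_card_filter_not (s := G) (fun g => γ j < g)
    have hmem : γ j ∈ s := Nat.nth_mem_of_infinite hinf' j
    have h4 : (Finset.range (γ j)).filter (fun x => ¬ x ∈ s) = G.filter fun g => ¬ γ j < g := by
      ext g
      simp only [Finset.mem_filter, Finset.mem_range, hG, Set.Finite.mem_toFinset,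
        Set.mem_compl_iff, not_lt]
      constructor
      · rintro ⟨h, h'⟩
        exact ⟨h', h.le⟩
      · rintro ⟨h, h'⟩
        exact ⟨lt_of_le_of_ne h' fun he => h (he ▸ hmem), h⟩
    rw [h1, h4, Finset.card_range] at h2
    simp only [col]
    omega
  have hbd : ∀ j, 0 < col j → j < G.sup id + 1 := by
    intro j hj
    obtain ⟨g, hg⟩ := Finset.card_pos.1 hj
    simp only [Finset.mem_filter] at hg
    have h1 : g ≤ G.sup id := Finset.le_sup (f := id) hg.1
    have h2 : j ≤ γ j := hmono.le_apply
    omega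
  let μ : YoungDiagram :=
    { cells := (Finset.range (G.card) ×ˢ Finset.range (G.sup id + 1)).filter
        fun x => x.1 < col x.2
      isLowerSet := by
        rintro ⟨i, j⟩ ⟨i', j'⟩ ⟨hi, hj⟩ h
        simp only [Finset.coe_filter, Finset.mem_product, Finset.mem_range, Set.mem_ofPred_eq]
          at h hi hj ⊢
        have := hanti hj
        omega }
  have hμ : ∀ i j, (i, j) ∈ μ ↔ i < col j := by
    intro i j
    have : (i, j) ∈ μ ↔ (i, j) ∈ μ.cells := (YoungDiagram.mem_cells _).symm
    rw [this]
    simp only [μ, Finset.mem_filter, Finset.mem_product, Finset.mem_range]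
    refine ⟨fun h => h.2, fun h => ⟨⟨?_, hbd j (by omega)⟩, h⟩⟩
    exact h.trans_le (Finset.card_filter_le _ _)
  have hlen : ∀ j, μ.colLen j = col j := by
    intro j
    refine le_antisymm ?_ ?_
    · by_contra! h
      exact lt_irrefl _ ((hμ _ _).1 (YoungDiagram.mem_iff_lt_colLen.2 h))
    · by_contra! h
      exact lt_irrefl _ (YoungDiagram.mem_iff_lt_colLen.1 ((hμ _ _).2 h))
  refine ⟨μ, fun x => ?_⟩
  rw [YoungDiagram.notMem_mayaSet_iff]
  constructor
  · rintro ⟨j, hj⟩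
    refine ⟨γ j, Nat.nth_mem_of_infinite hinf' j, ?_⟩
    have := hcol j
    rw [hlen] at hj
    omega
  · rintro ⟨n, hn, hx⟩
    refine ⟨Nat.count (· ∈ s) n, ?_⟩
    have := hcol (Nat.count (· ∈ s) n)
    have hc : γ (Nat.count (· ∈ s) n) = n := Nat.nth_count hn
    rw [hlen]
    omega

/-! ### Three-generated semigroups, and symmetry from a maximal core. -/

/-- `x` is a linear combination of `a`, `b`, `c` with natural number coefficients. -/
def IsNatComb (a b c : ℕ) (x : ℤ) : Prop :=
  ∃ i j k : ℕ, x = i * a + j * b + k * c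

/-- The numerical semigroup generated by `a`, `b`, `c` is symmetric. -/
def IsSymmTriple (a b c : ℕ) : Prop :=
  ∃ F : ℤ, ∀ x : ℤ, IsNatComb a b c x ↔ ¬ IsNatComb a b c (F - x)

theorem IsNatComb.nonneg {a b c : ℕ} {x : ℤ} (h : IsNatComb a b c x) : 0 ≤ x := by
  obtain ⟨i, j, k, rfl⟩ := h
  positivity

theorem isNatComb_zero (a b c : ℕ) : IsNatComb a b c 0 := ⟨0, 0, 0, by simp⟩

theorem IsNatComb.add {a b c : ℕ} {x y : ℤ} (hx : IsNatComb a b c x) (hy : IsNatComb a b c y) :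
    IsNatComb a b c (x + y) := by
  obtain ⟨i, j, k, rfl⟩ := hx
  obtain ⟨i', j', k', rfl⟩ := hy
  exact ⟨i + i', j + j', k + k', by push_cast; ring⟩

theorem IsNatComb.rotate {a b c : ℕ} {x : ℤ} (h : IsNatComb a b c x) : IsNatComb b c a x := by
  obtain ⟨i, j, k, rfl⟩ := h
  exact ⟨j, k, i, by ring⟩

theorem IsSymmTriple.rotate {a b c : ℕ} (h : IsSymmTriple a b c) : IsSymmTriple b c a := by
  obtain ⟨F, hF⟩ := h
  have key : ∀ x, IsNatComb b c a x ↔ IsNatComb a b c x :=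
    fun x => ⟨fun h => h.rotate.rotate, fun h => h.rotate⟩
  exact ⟨F, fun x => by rw [key, key]; exact hF x⟩

theorem finite_setOf_not_isNatComb {a b c : ℕ} (h : Nat.gcd (Nat.gcd a b) c = 1) :
    {n : ℕ | IsNatComb a b c n}ᶜ.Finite := by
  obtain ⟨N, hN⟩ := Nat.exists_mem_closure_of_ge ({a, b, c} : Set ℕ)
  refine (Set.finite_lt_nat N).subset fun n hn => ?_
  by_contra hlt
  refine hn ?_
  have hg : Nat.setGcd ({a, b, c} : Set ℕ) ∣ n := by
    have h1 : Nat.setGcd ({a, b, c} : Set ℕ) ∣ 1 := by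
      rw [← h]
      exact Nat.dvd_gcd (Nat.dvd_gcd (Nat.setGcd_dvd_of_mem (by simp))
        (Nat.setGcd_dvd_of_mem (by simp))) (Nat.setGcd_dvd_of_mem (by simp))
    exact h1.trans (one_dvd n)
  have hmem := hN n (not_lt.1 hlt) hg
  rw [Set.insert_eq, AddSubmonoid.closure_union, AddSubmonoid.mem_sup] at hmem
  obtain ⟨y, hy, z, hz, rfl⟩ := hmem
  obtain ⟨i, rfl⟩ := AddSubmonoid.mem_closure_singleton.1 hy
  obtain ⟨j, k, rfl⟩ := (AddSubmonoid.mem_closure_pair _ _ _).1 hz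
  exact ⟨i, j, k, by push_cast [smul_eq_mul]; ring⟩

theorem IsUM.isSymmTriple {a b c : ℕ} (ha : 0 < a) (hb : 0 < b) (hc : 0 < c)
    (habc : Nat.gcd (Nat.gcd a b) c = 1) (h : IsUM {a, b, c}) : IsSymmTriple a b c := by
  classical
  have hA : 0 ∉ ({a, b, c} : Set ℕ) := by
    simp only [Set.mem_insert_iff, Set.mem_singleton_iff]
    omega
  obtain ⟨κ, hκ, hmax⟩ := h
  have hself : κ.transpose = κ := by
    have h1 := (hmax _ hκ.transpose).le
    refine le_antisymm h1 ?_
    rw [← YoungDiagram.transpose_le_iff, YoungDiagram.transpose_transpose]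
    exact h1
  have hfin := finite_setOf_not_isNatComb habc
  set G := hfin.toFinset with hG
  obtain ⟨μ, hμ⟩ := exists_youngDiagram_mayaSet _ hfin
  have hμcore : IsCorePartition {a, b, c} μ := by
    rw [isCorePartition_iff_mayaSet hA]
    intro x hx y hy
    rw [hμ] at hx ⊢
    obtain ⟨n, hn, rfl⟩ := hx
    refine ⟨n + y, ?_, by push_cast; ring⟩
    have hy' : IsNatComb a b c y := by
      rcases hy with rfl | rfl | rfl
      · exact ⟨1, 0, 0, by simp⟩
      · exact ⟨0, 1, 0, by simp⟩
      · exact ⟨0, 0, 1, by simp⟩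
    have := IsNatComb.add hn hy'
    simpa using this
  set m := κ.colLen 0 with hm
  -- The core built from the semigroup has at least `G.card` parts, because its complement contains
  -- `-G.card`.
  have hGm : G.card ≤ m := by
    refine le_trans ?_ (hmax μ hμcore).1
    have h1 : (-(G.card : ℤ)) ∉ μ.mayaSet :=
      (hμ _).2 ⟨0, by simpa using isNatComb_zero a b c, by simp [hG]⟩
    obtain ⟨j, hj⟩ := YoungDiagram.notMem_mayaSet_iff.1 h1
    have := μ.colLen_anti 0 j (Nat.zero_le j)
    omega
  have hcl : ∀ x ∉ κ.mayaSet, ∀ y, IsNatComb a b c y → x + y ∉ κ.mayaSet := by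
    have hκ' := (isCorePartition_iff_mayaSet hA).1 hκ
    have hmul : ∀ t ∈ ({a, b, c} : Set ℕ), ∀ i : ℕ, ∀ x ∉ κ.mayaSet, x + i * t ∉ κ.mayaSet := by
      intro t ht i
      induction i with
      | zero => intro x hx; simpa using hx
      | succ i ih =>
        intro x hx
        have := hκ' _ (ih x hx) t ht
        convert this using 2
        push_cast
        ring
    rintro x hx y ⟨i, j, k, rfl⟩
    have := hmul c (by simp) k _ (hmul b (by simp) j _ (hmul a (by simp) i x hx))
    convert this using 2
    ring
  have hm0 : (-(m : ℤ)) ∉ κ.mayaSet := YoungDiagram.notMem_mayaSet_iff.2 ⟨0, by simp [hm]⟩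
  -- Positions of the first m vertical steps of κ, shifted by m. They are m distinct gaps, so with
  -- `hGm` they are all the gaps.
  let f : ℕ → ℕ := fun i => κ.rowLen i + m - i - 1
  have hf : ∀ i < m, ((f i : ℕ) : ℤ) - m = κ.rowLen i - i - 1 := by
    intro i hi
    simp only [f]
    omega
  have hinj : Set.InjOn f (Finset.range m) := by
    intro i hi j hj hij
    simp only [Finset.coe_range, Set.mem_Iio] at hi hj
    have h1 := hf i hi
    have h2 := hf j hj
    rw [hij] at h1
    rcases le_total i j with h | h
    · have := κ.rowLen_anti i j h
      omega
    · have := κ.rowLen_anti j i h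
      omega
  have hsub : (Finset.range m).image f ⊆ G := by
    intro g hg
    obtain ⟨i, hi, rfl⟩ := Finset.mem_image.1 hg
    rw [hG, Set.Finite.mem_toFinset]
    intro hcomb
    refine hcl _ hm0 _ hcomb ⟨i, ?_⟩
    have := hf i (Finset.mem_range.1 hi)
    omega
  have heq : (Finset.range m).image f = G := by
    refine Finset.eq_of_subset_of_card_le hsub ?_
    rwa [Finset.card_image_of_injOn hinj, Finset.card_range]
  have hiff : ∀ x : ℤ, IsNatComb a b c x ↔ x - m ∉ κ.mayaSet := by
    intro x
    constructor
    · intro hx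
      have := hcl _ hm0 _ hx
      rwa [neg_add_eq_sub] at this
    · intro hx
      have hx0 : 0 ≤ x := by
        obtain ⟨j, hj⟩ := YoungDiagram.notMem_mayaSet_iff.1 hx
        have := κ.colLen_anti 0 j (Nat.zero_le j)
        omega
      obtain ⟨n, rfl⟩ := Int.eq_ofNat_of_zero_le hx0
      by_contra hn
      have hnG : n ∈ G := by
        rw [hG, Set.Finite.mem_toFinset]
        exact hn
      rw [← heq] at hnG
      obtain ⟨i, hi, rfl⟩ := Finset.mem_image.1 hnG
      exact hx ⟨i, hf i (Finset.mem_range.1 hi)⟩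
  -- The reflection x ↦ -1 - x from self-conjugacy, conjugated by the shift by m, becomes x ↦ 2m - 1
  -- - x.
  refine ⟨2 * m - 1, fun x => ?_⟩
  rw [hiff, hiff, not_not]
  have := YoungDiagram.mayaSet_transpose (μ := κ) (x := 2 * m - 1 - x - m)
  rw [hself] at this
  rw [this]
  ring_nf

/-! ### Removing common factors. -/

/-- Removing a common factor of two generators preserves symmetry. -/
theorem IsSymmTriple.of_mul {p a b c : ℕ} (hp : 0 < p) (hc : 0 < c) (hpc : Nat.Coprime p c)
    (h : IsSymmTriple (p * a) (p * b) c) : IsSymmTriple a b c := by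
  obtain ⟨F, hF⟩ := h
  have hpc' : IsCoprime (p : ℤ) (c : ℤ) := Nat.isCoprime_iff_coprime.2 hpc
  -- As p and c are coprime, the residue mod p fixes the coefficient of c up to multiples of p, and
  -- it is at least j.
  have hiff : ∀ (x : ℤ) (j : ℕ), j < p →
      (IsNatComb (p * a) (p * b) c (p * x + j * c) ↔ IsNatComb a b c x) := by
    intro x j hj
    constructor
    · rintro ⟨u, v, w, hw⟩
      have hdvd : (p : ℤ) ∣ (w - j) * c := ⟨x - u * a - v * b, by push_cast at hw; linarith⟩
      obtain ⟨t, ht⟩ := hpc'.dvd_of_dvd_mul_right hdvd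
      have hp' : (0 : ℤ) < p := by exact_mod_cast hp
      have ht0 : 0 ≤ t := by
        by_contra! hneg
        have : (p : ℤ) * t ≤ p * (-1) := by gcongr; omega
        omega
      obtain ⟨t, rfl⟩ := Int.eq_ofNat_of_zero_le ht0
      refine ⟨u, v, t, ?_⟩
      have hw' : (w : ℤ) = j + p * t := by linarith
      apply mul_left_cancel₀ hp'.ne'
      rw [hw'] at hw
      push_cast at hw
      linarith
    · rintro ⟨u, v, w, rfl⟩
      exact ⟨u, v, p * w + j, by push_cast; ring⟩
  have hdec : ∃ (x : ℤ) (j : ℕ), j < p ∧ F - (p - 1 : ℕ) * c = p * x + j * c := by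
    obtain ⟨u, v, huv⟩ := hpc'
    set N := F - (p - 1 : ℕ) * c with hN
    have hp' : (0 : ℤ) < p := by exact_mod_cast hp
    obtain ⟨j, hj⟩ := Int.eq_ofNat_of_zero_le (Int.emod_nonneg (N * v) hp'.ne')
    have hlt := Int.emod_lt_of_pos (N * v) hp'
    have hdm := Int.emod_add_mul_ediv (N * v) p
    refine ⟨N * u + (N * v / p) * c, j, by omega, ?_⟩
    rw [hj] at hdm
    linear_combination -N * huv - c * hdm
  obtain ⟨x, j, hj, hx⟩ := hdec
  have hpcast : ((p - 1 : ℕ) : ℤ) = p - 1 := by push_cast [Nat.cast_sub hp]; ring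
  rcases j with _ | j
  · refine ⟨x, fun z => ?_⟩
    have h1 := hF (p * z + (0 : ℕ) * c)
    have h2 : F - (p * z + (0 : ℕ) * c) = p * (x - z) + (p - 1 : ℕ) * c := by
      linear_combination hx
    rw [h2, hiff _ _ hp, hiff _ _ (by omega)] at h1
    exact h1
  -- For a nonzero residue, the smaller semigroup would be symmetric about both x and x + c;
  -- evaluating at x + c contradicts this, since 0 belongs to it and -c does not.
  · exfalso
    have hA : ∀ z, IsNatComb a b c z ↔ ¬ IsNatComb a b c (x + c - z) := by
      intro z
      have h1 := hF (p * z + (0 : ℕ) * c)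
      have h2 : F - (p * z + (0 : ℕ) * c) = p * (x + c - z) + j * c := by
        rw [hpcast] at hx
        push_cast at hx ⊢
        linear_combination hx
      rw [h2, hiff _ _ hp, hiff _ _ (by omega)] at h1
      exact h1
    have hB : ∀ z, IsNatComb a b c z ↔ ¬ IsNatComb a b c (x - z) := by
      intro z
      have h1 := hF (p * z + (j + 1 : ℕ) * c)
      have h2 : F - (p * z + (j + 1 : ℕ) * c) = p * (x - z) + (p - 1 : ℕ) * c := by
        linear_combination hx
      rw [h2, hiff _ _ hj, hiff _ _ (by omega)] at h1
      exact h1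
    have h1 := hA (x + c)
    have h2 := hB (x + c)
    rw [sub_self] at h1
    rw [show x - (x + c) = -(c : ℤ) by ring] at h2
    have h3 : ¬ IsNatComb a b c (-(c : ℤ)) := fun h => by
      have := h.nonneg
      omega
    exact (h1.1 (h2.2 h3)) (isNatComb_zero a b c)

/-! ### Apéry sets. -/

theorem IsNatComb.swap {a b c : ℕ} {x : ℤ} (h : IsNatComb a b c x) : IsNatComb a c b x := by
  obtain ⟨i, j, k, rfl⟩ := h
  exact ⟨i, k, j, by ring⟩

/-- `x` lies in the Apéry set with respect to `d` of the semigroup generated by `d`, `e`, `f`. -/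
def IsApery (d e f : ℕ) (x : ℤ) : Prop :=
  IsNatComb d e f x ∧ ¬ IsNatComb d e f (x - d)

namespace IsApery

variable {d e f : ℕ} {x y : ℤ}

theorem swap (h : IsApery d e f x) : IsApery d f e x :=
  ⟨h.1.swap, fun h' => h.2 h'.swap⟩

theorem of_add (h : IsApery d e f (x + y)) (hx : IsNatComb d e f x) (hy : IsNatComb d e f y) :
    IsApery d e f x := by
  refine ⟨hx, fun h' => h.2 ?_⟩
  have := h'.add hy
  rwa [sub_add_eq_add_sub] at this

theorem exists_eq (h : IsApery d e f x) : ∃ i j : ℕ, x = i * e + j * f := by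
  obtain ⟨⟨u, i, j, rfl⟩, h2⟩ := h
  rcases u with _ | u
  · exact ⟨i, j, by simp⟩
  · exact absurd ⟨u, i, j, by push_cast; ring⟩ h2

theorem eq_of_le_of_dvd (hx : IsApery d e f x) (hy : IsApery d e f y) (hxy : x ≤ y)
    (h : (d : ℤ) ∣ y - x) : x = y := by
  obtain ⟨t, ht⟩ := h
  by_contra hne
  have hpos : 0 < (d : ℤ) * t := by omega
  have ht0 : 0 < t := pos_of_mul_pos_right hpos (by positivity)
  obtain ⟨s, rfl⟩ : ∃ s : ℕ, t = s + 1 := ⟨(t - 1).toNat, by omega⟩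
  refine hy.2 ?_
  have := hx.1.add (y := s * d) ⟨s, 0, 0, by simp⟩
  convert this using 1
  linear_combination ht

/-- Each class mod d has at most one Apéry element: a larger one would remain in the semigroup after
subtracting d. -/
theorem eq_of_dvd (hx : IsApery d e f x) (hy : IsApery d e f y) (h : (d : ℤ) ∣ y - x) :
    x = y := by
  rcases le_total x y with hxy | hxy
  · exact hx.eq_of_le_of_dvd hy hxy h
  · exact (hy.eq_of_le_of_dvd hx hxy (by rwa [dvd_sub_comm])).symm

end IsApery

theorem IsNatComb.exists_isApery {d e f : ℕ} (hd : 0 < d) {x : ℤ} (h : IsNatComb d e f x) :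
    ∃ (t : ℕ) (w : ℤ), IsApery d e f w ∧ x = t * d + w := by
  have key : ∀ (n : ℕ) (x : ℤ), x < n → IsNatComb d e f x →
      ∃ (t : ℕ) (w : ℤ), IsApery d e f w ∧ x = t * d + w := by
    intro n
    induction n with
    | zero =>
      intro x hx h
      have := h.nonneg
      simp only [Nat.cast_zero] at hx
      omega
    | succ n ih =>
      intro x hx h
      by_cases h' : IsNatComb d e f (x - d)
      · obtain ⟨t, w, hw, he⟩ := ih (x - d) (by push_cast at hx; omega) h'
        exact ⟨t + 1, w, hw, by push_cast; linear_combination he⟩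
      · exact ⟨0, x, ⟨h, h'⟩, by simp⟩
  exact key (x.toNat + 1) x (by omega) h

/-- The least multiple of `e` outside the Apéry set with respect to `d`. -/
theorem exists_isApery_mul_iff {d e : ℕ} (f : ℕ) (hd : 0 < d) (he : 0 < e) :
    ∃ K : ℕ, 0 < K ∧ K ≤ d ∧ (∀ i : ℕ, IsApery d e f (i * e) ↔ i < K) ∧
      ∃ α γ : ℕ, (K : ℤ) * e = α * d + γ * f ∧ IsApery d e f (γ * f) := by
  classical
  have hcomb : ∀ i : ℕ, IsNatComb d e f (i * e) := fun i => ⟨0, i, 0, by simp⟩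
  have hdn : ¬ IsApery d e f (d * e) := fun h => h.2 ⟨e - 1, 0, 0, by
    rw [Nat.cast_sub he]; push_cast; ring⟩
  have hex : ∃ K : ℕ, ¬ IsApery d e f (K * e) := ⟨d, hdn⟩
  obtain ⟨K, hK, hmin⟩ : ∃ K : ℕ, ¬ IsApery d e f (K * e) ∧ ∀ i < K, IsApery d e f (i * e) :=
    ⟨Nat.find hex, Nat.find_spec hex, fun i hi => not_not.1 (Nat.find_min hex hi)⟩
  have hiff : ∀ i : ℕ, IsApery d e f (i * e) ↔ i < K := by
    refine fun i => ⟨fun h => ?_, hmin i⟩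
    by_contra! hle
    obtain ⟨j, rfl⟩ := Nat.exists_eq_add_of_le hle
    refine hK (IsApery.of_add (y := j * e) ?_ (hcomb K) (hcomb j))
    convert h using 1
    push_cast
    ring
  have h0 : IsApery d e f ((0 : ℕ) * e) := ⟨hcomb 0, fun h => by
    have := h.nonneg
    simp only [Nat.cast_zero, zero_mul] at this
    omega⟩
  refine ⟨K, (hiff 0).1 h0, ?_, hiff, ?_⟩
  · by_contra! h
    exact hdn (hmin d h)
  · obtain ⟨α, w, hw, hKw⟩ := (hcomb K).exists_isApery hd
    obtain ⟨i, j, rfl⟩ := hw.exists_eq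
    have hα : α ≠ 0 := by
      rintro rfl
      refine hK ?_
      rw [hKw]
      simpa using hw
    have hi : IsApery d e f (i * e) := hw.of_add (hcomb i) ⟨0, 0, j, by simp⟩
    have hj : IsApery d e f (j * f) := by
      rw [add_comm] at hw
      exact hw.of_add ⟨0, 0, j, by simp⟩ (hcomb i)
    -- Otherwise cancelling ie leaves (K - i)e with a positive multiple of d, against the minimality
    -- of K.
    have hi0 : i = 0 := by
      by_contra hi0
      have hlt := (hiff i).1 hi
      have hA := (hiff (K - i)).2 (by omega)
      refine hA.2 ⟨α - 1, 0, j, ?_⟩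
      rw [Nat.cast_sub hlt.le, Nat.cast_sub (Nat.pos_of_ne_zero hα)]
      push_cast
      linear_combination hKw
    subst hi0
    exact ⟨α, j, by simpa using hKw, hj⟩

/-- In a symmetric semigroup, the largest element of the Apéry set dominates every other one. -/
theorem exists_frobenius_add_eq {d e f : ℕ} {F : ℤ}
    (hF : ∀ x : ℤ, IsNatComb d e f x ↔ ¬ IsNatComb d e f (F - x)) {K : ℕ}
    (hK0 : 0 < K) (hK : ∀ i : ℕ, IsApery d e f (i * e) ↔ i < K) :
    IsApery d e f (F + d) ∧
      ∃ j : ℕ, F + d = (K - 1) * e + j * f ∧ IsApery d e f (j * f) := by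
  have hmax : ∀ w, IsApery d e f w → IsNatComb d e f (F + d - w) := by
    intro w hw
    have := mt (hF (w - d)).2 hw.2
    rw [not_not] at this
    convert this using 1
    ring
  have h0 : IsApery d e f 0 := by simpa using (hK 0).2 hK0
  have hFd : IsApery d e f (F + d) := by
    refine ⟨by simpa using hmax 0 h0, ?_⟩
    have := (hF 0).1 h0.1
    simpa using this
  refine ⟨hFd, ?_⟩
  have hz := hmax _ ((hK (K - 1)).2 (by omega))
  rw [Nat.cast_sub hK0, Nat.cast_one] at hz
  have hKe : IsNatComb d e f ((K - 1 : ℤ) * e) := ⟨0, K - 1, 0, by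
    rw [Nat.cast_sub hK0]; simp⟩
  have hzA : IsApery d e f (F + d - (K - 1) * e) := by
    refine IsApery.of_add (y := (K - 1) * e) ?_ hz hKe
    simpa using hFd
  obtain ⟨i, j, hij⟩ := hzA.exists_eq
  have hj : IsApery d e f (j * f) := by
    rw [hij, add_comm] at hzA
    exact hzA.of_add ⟨0, 0, j, by simp⟩ ⟨0, i, 0, by simp⟩
  rcases i with _ | i
  · refine ⟨j, ?_, hj⟩
    rw [Nat.cast_zero, zero_mul, zero_add] at hij
    linear_combination hij
  -- A further e in the expansion would make Ke a summand of the Apéry element F + d.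
  · refine absurd ((hK K).1 (IsApery.of_add (y := i * e + j * f) ?_ ⟨0, K, 0, by simp⟩
      ⟨0, i, j, by simp⟩)) (lt_irrefl K)
    convert hFd using 1
    push_cast at hij
    linear_combination -hij

/-! ### Symmetric semigroups with pairwise coprime generators. -/

/-- A symmetric numerical semigroup with three pairwise coprime generators, the first of which is
the smallest, has a redundant generator. -/
theorem IsSymmTriple.isAprimitive_of_le {d e f : ℕ} (hd : 0 < d) (hde : d ≤ e) (hdf : d ≤ f)
    (cde : Nat.Coprime d e) (cdf : Nat.Coprime d f) (cef : Nat.Coprime e f)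
    (h : IsSymmTriple d e f) : e ∈ AddSubmonoid.closure ({d, f} : Set ℕ) ∨
      f ∈ AddSubmonoid.closure ({d, e} : Set ℕ) := by
  obtain ⟨F, hF⟩ := h
  have swap_iff : ∀ x, IsNatComb d f e x ↔ IsNatComb d e f x := fun x => ⟨.swap, .swap⟩
  have swap_iff' : ∀ x, IsApery d f e x ↔ IsApery d e f x := fun x => ⟨.swap, .swap⟩
  obtain ⟨K, hK0, hKd, hK, α, γ, hKe, hγ⟩ :=
    exists_isApery_mul_iff f hd (hd.trans_le hde)
  obtain ⟨L, hL0, hLd, hL, β, δ, hLf, hδ⟩ :=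
    exists_isApery_mul_iff e hd (hd.trans_le hdf)
  obtain ⟨hFd, j, hj, hjA⟩ := exists_frobenius_add_eq hF hK0 hK
  obtain ⟨-, i, hi, hiA⟩ := exists_frobenius_add_eq (e := f) (f := e)
    (fun x => by rw [swap_iff, swap_iff]; exact hF x) hL0 hL
  rw [swap_iff', hK] at hδ hiA
  rw [← swap_iff', hL] at hγ hjA
  -- Compare the two expansions of F + d: f divides K - 1 - i, whose absolute value is below K ≤ d ≤
  -- f. This is where the minimality of d enters.
  have hiK : i = K - 1 := by
    have hdvd : (f : ℤ) ∣ (K - 1 - i) * e := ⟨L - 1 - j, by linear_combination hi - hj⟩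
    have hdvd' := (Nat.isCoprime_iff_coprime.2 cef.symm).dvd_of_dvd_mul_right hdvd
    have ht0 : (K : ℤ) - 1 - i = 0 := Int.eq_zero_of_abs_lt_dvd hdvd' (by rw [abs_lt]; omega)
    omega
  -- F + d = (K - 1)e + (L - 1)f, and summands of Apéry elements are Apéry.
  have hbox : ∀ u < K, ∀ v < L, IsApery d e f (u * e + v * f) := by
    intro u hu v hv
    refine IsApery.of_add (y := (K - 1 - u : ℕ) * e + (L - 1 - v : ℕ) * f) ?_
      ⟨0, u, v, by simp⟩ ⟨0, K - 1 - u, L - 1 - v, by simp⟩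
    convert hFd using 1
    rw [hi, hiK, Nat.cast_sub (by omega : u ≤ K - 1), Nat.cast_sub (by omega : v ≤ L - 1),
      Nat.cast_sub (by omega : 1 ≤ L)]
    push_cast
    ring
  have hf0 : (0 : ℤ) < f := by omega
  have hKL : K * L ≤ d := by
    have hcard : (Finset.range K ×ˢ Finset.range L).card ≤ (Finset.range d).card := by
      refine Finset.card_le_card_of_injOn (fun u => (u.1 * e + u.2 * f) % d) ?_ ?_
      · intro u _
        simpa using Nat.mod_lt _ hd
      · rintro ⟨u, v⟩ huv ⟨u', v'⟩ huv' heq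
        simp only [Finset.coe_product, Finset.coe_range, Set.mem_prod, Set.mem_Iio] at huv huv'
        have hmod : (u * e + v * f) ≡ (u' * e + v' * f) [MOD d] := heq
        have hdvd := (Nat.modEq_iff_dvd).1 hmod
        push_cast at hdvd
        have hEq := (hbox u huv.1 v huv.2).eq_of_dvd (hbox u' huv'.1 v' huv'.2) hdvd
        have hfd : (f : ℤ) ∣ (u - u') * e := ⟨v' - v, by linear_combination hEq⟩
        have hfd' := (Nat.isCoprime_iff_coprime.2 cef.symm).dvd_of_dvd_mul_right hfd
        have hu : (u : ℤ) - u' = 0 := Int.eq_zero_of_abs_lt_dvd hfd' (by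
          rw [abs_lt]; omega)
        have huu : u = u' := by omega
        subst huu
        have hvv : (v : ℤ) * f = v' * f := by linear_combination hEq
        have := mul_right_cancel₀ hf0.ne' hvv
        simp only [Prod.mk.injEq, true_and]
        exact_mod_cast this
    simpa using hcard
  -- Mod d, Ke ≡ γf and Lf ≡ δe; multiply the two congruences.
  have hdet : (d : ℤ) ∣ (K * L - γ * δ) * (e * f) :=
    ⟨α * β * d + α * δ * e + β * γ * f, by
      linear_combination (L : ℤ) * f * hKe + (α * d + γ * f) * hLf⟩
  have hdet' : (d : ℤ) ∣ K * L - γ * δ := by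
    have hc := Nat.isCoprime_iff_coprime.2 (cde.mul_right cdf)
    push_cast at hc
    exact hc.dvd_of_dvd_mul_right hdet
  have hlt : γ * δ < K * L := by
    rw [mul_comm K L]
    exact Nat.mul_lt_mul'' hγ hδ
  have hge : (d : ℤ) ≤ K * L - γ * δ := Int.le_of_dvd (by
    have : ((γ * δ : ℕ) : ℤ) < (K * L : ℕ) := by exact_mod_cast hlt
    push_cast at this
    omega) hdet'
  -- d ≤ KL - γδ and KL ≤ d leave no room for γδ.
  have hzero : γ * δ = 0 := by
    have h1 : ((K * L : ℕ) : ℤ) ≤ d := by exact_mod_cast hKL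
    have h2 : ((γ * δ : ℕ) : ℤ) ≤ 0 := by
      push_cast at h1 ⊢
      omega
    omega
  rcases Nat.mul_eq_zero.1 hzero with rfl | rfl
  · right
    -- With γ = 0, Ke = αd; thus K = d, then L = 1, and Lf = βd + δe expresses f.
    have hdK : d ∣ K := cde.dvd_of_dvd_mul_right ⟨α, by
      have : (K * e : ℕ) = α * d := by
        have := hKe
        push_cast at this
        simp only [zero_mul, add_zero] at this
        exact_mod_cast this
      rw [this, mul_comm]⟩
    have hKd' : K = d := le_antisymm hKd (Nat.le_of_dvd hK0 hdK)
    have hL1 : L = 1 := by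
      have : d * L ≤ d * 1 := by rw [← hKd'] at hKL ⊢; simpa using hKL
      have := Nat.le_of_mul_le_mul_left this hd
      omega
    rw [AddSubmonoid.mem_closure_pair]
    refine ⟨β, δ, ?_⟩
    rw [hL1] at hLf
    simp only [smul_eq_mul]
    push_cast at hLf
    rw [one_mul] at hLf
    exact_mod_cast hLf.symm
  · left
    have hdL : d ∣ L := cdf.dvd_of_dvd_mul_right ⟨β, by
      have : (L * f : ℕ) = β * d := by
        have := hLf
        push_cast at this
        simp only [zero_mul, add_zero] at this
        exact_mod_cast this
      rw [this, mul_comm]⟩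
    have hLd' : L = d := le_antisymm hLd (Nat.le_of_dvd hL0 hdL)
    have hK1 : K = 1 := by
      have : K * d ≤ 1 * d := by rw [← hLd'] at hKL ⊢; simpa using hKL
      have := Nat.le_of_mul_le_mul_right this hd
      omega
    rw [AddSubmonoid.mem_closure_pair]
    refine ⟨α, γ, ?_⟩
    rw [hK1] at hKe
    simp only [smul_eq_mul]
    push_cast at hKe
    rw [one_mul] at hKe
    exact_mod_cast hKe.symm

theorem IsAprimitive.rotate {d e f : ℕ} (h : IsAprimitive d e f) : IsAprimitive e f d := by
  rcases h with h | h | h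
  · exact Or.inr (Or.inr h)
  · exact Or.inl (by rwa [Set.pair_comm])
  · exact Or.inr (Or.inl (by rwa [Set.pair_comm]))

theorem IsSymmTriple.isAprimitive {d e f : ℕ} (hd : 0 < d) (he : 0 < e) (hf : 0 < f)
    (cde : Nat.Coprime d e) (cdf : Nat.Coprime d f) (cef : Nat.Coprime e f)
    (h : IsSymmTriple d e f) : IsAprimitive d e f := by
  by_cases h1 : d ≤ e ∧ d ≤ f
  · exact Or.inr (h.isAprimitive_of_le hd h1.1 h1.2 cde cdf cef)
  by_cases h2 : e ≤ f ∧ e ≤ d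
  · have : IsAprimitive e f d :=
      Or.inr (h.rotate.isAprimitive_of_le he h2.1 h2.2 cef cde.symm cdf.symm)
    exact this.rotate.rotate
  · have : IsAprimitive f d e :=
      Or.inr (h.rotate.rotate.isAprimitive_of_le hf (by omega) (by omega) cdf.symm cef.symm cde)
    exact this.rotate

/-! ### Assembly. -/

theorem theorem1p3 (a b c : ℕ) (ha : 0 < a) (hb : 0 < b) (hc : 0 < c)
    (habc : Nat.gcd (Nat.gcd a b) c = 1)
    (p q r : ℕ) (hp : p = Nat.gcd a b) (hq : q = Nat.gcd a c) (hr : r = Nat.gcd b c)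
    (d e f : ℕ) (hd : a = d * p * q) (he : b = e * p * r) (hf : c = f * q * r)
    (hUM : IsUM {a, b, c}) :
    IsAprimitive d e f := by
  have hsymm := hUM.isSymmTriple ha hb hc habc
  have hp0 : 0 < p := hp ▸ Nat.gcd_pos_of_pos_left b ha
  have hq0 : 0 < q := hq ▸ Nat.gcd_pos_of_pos_left c ha
  have hr0 : 0 < r := hr ▸ Nat.gcd_pos_of_pos_left c hb
  have hd0 : 0 < d := Nat.pos_of_ne_zero fun h => by simp [h] at hd; omega
  have he0 : 0 < e := Nat.pos_of_ne_zero fun h => by simp [h] at he; omega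
  have hf0 : 0 < f := Nat.pos_of_ne_zero fun h => by simp [h] at hf; omega
  have cab : Nat.Coprime (d * q) (e * r) := by
    have h1 : p * Nat.gcd (d * q) (e * r) = p * 1 := by
      rw [← Nat.gcd_mul_left, mul_one, hp]
      nth_rw 3 [hd, he]
      rw [← hp]
      congr 1 <;> ring
    exact Nat.eq_of_mul_eq_mul_left hp0 h1
  have cac : Nat.Coprime (d * p) (f * r) := by
    have h1 : q * Nat.gcd (d * p) (f * r) = q * 1 := by
      rw [← Nat.gcd_mul_left, mul_one, hq]
      nth_rw 3 [hd, hf]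
      rw [← hq]
      congr 1 <;> ring
    exact Nat.eq_of_mul_eq_mul_left hq0 h1
  have cbc : Nat.Coprime (e * p) (f * q) := by
    have h1 : r * Nat.gcd (e * p) (f * q) = r * 1 := by
      rw [← Nat.gcd_mul_left, mul_one, hr]
      nth_rw 3 [he, hf]
      rw [← hr]
      congr 1 <;> ring
    exact Nat.eq_of_mul_eq_mul_left hr0 h1
  simp only [Nat.coprime_mul_iff_left, Nat.coprime_mul_iff_right] at cab cac cbc
  -- Divide out p, then q, then r, rotating the generators so that the pair sharing the factor comes
  -- first.
  have s1 : IsSymmTriple (d * q) (e * r) c := by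
    refine IsSymmTriple.of_mul hp0 hc (hp ▸ habc) ?_
    convert hsymm using 1
    · rw [hd]; ring
    · rw [he]; ring
  have s2 : IsSymmTriple (f * r) d (e * r) := by
    refine IsSymmTriple.of_mul hq0 (by positivity) ?_ (?_ : IsSymmTriple (q * (f * r)) (q * d) _)
    · exact Nat.coprime_mul_iff_right.2 ⟨cab.1.2, cab.2.2⟩
    · convert s1.rotate.rotate using 1
      · rw [hf]; ring
      · ring
  have s3 : IsSymmTriple e f d := by
    refine IsSymmTriple.of_mul hr0 hd0 ?_ (?_ : IsSymmTriple (r * e) (r * f) _)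
    · exact cab.2.1.symm
    · convert s2.rotate.rotate using 1
      · ring
      · ring
  exact s3.rotate.rotate.isAprimitive hd0 he0 hf0 cab.1.1 cac.1.1 cbc.1.1
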